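/- A randomised online algorithm with $s$ bits of space for patterns of length $m$ over an alphabet $\Sigma$ has a memory consisting of $s$ bits. It preprocesses a pattern $P\in\Sigma^m$, which sets the memory to a random value whose law depends only on $P$. Then the symbols $T[0],T[1],\dots\in\Sigma$ of a text stream arrive one at a time; on each arrival the algorithm uses fresh private coins to update its memory and to report a number, the joint law of these two depending only on the current memory content and the arriving symbol. (In particular, the pattern, earlier text symbols and earlier random bits are available only as far as they are stored in the memory.) The algorithm solves the online Hamming distance problem with success probability at least $p$ if for every pattern $P$, every text stream $T$ and every $i\ge 0$, the number reported on the arrival of $T[i+m-1]$ equals the Hamming distance $|\{j\in\{0,\dots,m-1\} : P[j]\neq T[i+j]\}|$ with probability at least $p$. **Theorem.** For all constants $\varepsilon>0$, $c>0$ and $p>1/2$ there is a constant $C>0$, depending only on $\varepsilon$, $c$ and $p$, such that for all integers $m\ge 1$ and $U\ge 2$ with $U\ge c\,m^{1+\varepsilon}$, every randomised online algorithm that solves the online Hamming distance problem for patterns of length $m$ over an alphabet of size $U$ with success probability at least $p$ uses at least $$C\,\bigl(m\log_2 m+\log_2\log_2 U\bigr)$$ bits of space. That is, online Hamming distance over a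 universe of size $U=\Omega(m^{1+\varepsilon})$ requires $\Omega(m\log m+\log\log U)$ bits of space. -/

import Mathlib

/-- A randomised online pattern matching algorithm with `s` bits of memory, for patterns of length
`m` over the alphabet `α`.  Its whole memory is a string of `s` bits.

* `init P` is the (random) content of the memory once the pattern `P` has been preprocessed.
  Afterwards `P` is available only through the memory.
* `step σ a` is the joint law of the new memory content and of the reported number when the text
  symbol `a` arrives while the memory content is `σ`.

The coins are private: every call of `init` and `step` uses fresh random bits, and a random bit
that is to be used again later has to be kept in the memory. No bound is put on computation time
or on the working space used inside a single call. -/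
structure OnlineAlgorithm (α : Type*) (m s : ℕ) where
  init : (Fin m → α) → PMF (Fin s → Bool)
  step : (Fin s → Bool) → α → PMF ((Fin s → Bool) × ℕ)

namespace OnlineAlgorithm

variable {α : Type*} {m s : ℕ}

/-- The law of the memory content after the pattern `P` and the first `n` symbols
`T 0, …, T (n - 1)` of the text stream have been processed. -/
noncomputable def stateLaw (A : OnlineAlgorithm α m s) (P : Fin m → α) (T : ℕ → α) :
    ℕ → PMF (Fin s → Bool)
  | 0 => A.init P
  | n + 1 => (A.stateLaw P T n).bind fun σ => (A.step σ (T n)).map Prod.fst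

/-- The law of the number reported when the symbol `T n` of the text stream arrives. -/
noncomputable def outputLaw (A : OnlineAlgorithm α m s) (P : Fin m → α) (T : ℕ → α) (n : ℕ) :
    PMF ℕ :=
  (A.stateLaw P T n).bind fun σ => (A.step σ (T n)).map Prod.snd

/-- `A` solves the online Hamming distance problem with success probability at least `p`: for every
pattern, every text stream and every alignment `i`, the number reported when the last symbol
`T (i + m - 1)` of the window `T i, …, T (i + m - 1)` arrives is, with probability at least `p`,
the Hamming distance between the pattern and that window. -/
def SolvesHamming [DecidableEq α] (A : OnlineAlgorithm α m s) (p : ℝ) : Prop :=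
  ∀ (P : Fin m → α) (T : ℕ → α) (i n : ℕ), n + 1 = i + m →
    ENNReal.ofReal p ≤ A.outputLaw P T n (hammingDist P fun j : Fin m => T (i + j))

end OnlineAlgorithm

/-! Only the first window matters: the memory left by preprocessing is a random message about the
pattern, and any text of length `m` acts as a query on it. For log log U, take constant patterns.
The text of constant symbol `b` tests whether the pattern is `b`, and rounding the tests to
multiples of 1/N shows that 2^s states distinguish at most (N+1)^(2^s) symbols
(`card_le_pow_of_distinguish`). For m log m, take patterns that permute `m` distinct symbols, with
one further symbol as filler. A suitable text reads any one binary digit of the position of any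
symbol. With L = ⌈log₂ m⌉, the mL digits form a random access code with m! codewords, so 2^s ≥
m!·(e^η/2)^(mL), η = (2p-1)²/8 (`card_mul_pow_le_card_of_readable`). Since m! and 2^(mL) agree up to
e^(O(m)), a term η·m·log m survives. The filler needs U ≥ m + 1, which the growth hypothesis gives
for large `m`. -/

open Finset

/-! ### Counting bounds for random encodings -/

/-- A finite average of a function that is at least `c` is attained or exceeded somewhere. -/
theorem exists_le_of_le_weighted_sum {S : Type*} [Fintype S] (μ f : S → ℝ) (c : ℝ)
    (hμ : ∀ σ, 0 ≤ μ σ) (hsum : ∑ σ, μ σ = 1) (h : c ≤ ∑ σ, μ σ * f σ) : ∃ σ, c ≤ f σ := by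
  by_contra! hlt
  have hpos : ∃ σ ∈ (univ : Finset S), 0 < μ σ := by
    by_contra! hn
    have : ∑ σ, μ σ ≤ 0 := Finset.sum_nonpos fun σ hσ => hn σ hσ
    linarith
  have h1 : 0 < ∑ σ, μ σ * (c - f σ) := by
    apply Finset.sum_pos'
    · exact fun σ _ => mul_nonneg (hμ σ) (by linarith [hlt σ])
    · obtain ⟨σ, hσ, h0⟩ := hpos
      exact ⟨σ, hσ, mul_pos h0 (by linarith [hlt σ])⟩
  simp only [mul_sub, Finset.sum_sub_distrib, ← Finset.sum_mul, hsum] at h1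
  linarith

/-- Private-coin equality: if the tests `K a` distinguish the distribution `μ a` from every other
one with success probability `p`, then there are at most `(N + 1) ^ |S|` distributions. -/
theorem card_le_pow_of_distinguish {S ι : Type*} [Fintype S] [Fintype ι]
    (μ K : ι → S → ℝ) (p : ℝ) (N : ℕ) (hN : 0 < N) (hNp : 1 / (N : ℝ) < 2 * p - 1)
    (hμ : ∀ a σ, 0 ≤ μ a σ) (hsum : ∀ a, ∑ σ, μ a σ = 1)
    (hK0 : ∀ a σ, 0 ≤ K a σ) (hK1 : ∀ a σ, K a σ ≤ 1)
    (hacc : ∀ a, p ≤ ∑ σ, μ a σ * K a σ)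
    (hrej : ∀ a b, a ≠ b → ∑ σ, μ a σ * K b σ ≤ 1 - p) :
    Fintype.card ι ≤ (N + 1) ^ Fintype.card S := by
  classical
  have hNR : (0 : ℝ) < N := by exact_mod_cast hN
  -- Equal roundings would let test `b` accept `μ a` with probability at least p - 1/N > 1 - p.
  let g : ι → S → Fin (N + 1) := fun a σ => ⟨⌊N * K a σ⌋₊, by
    rw [Nat.lt_succ_iff]
    refine Nat.floor_le_of_le ?_
    nlinarith [hK1 a σ]⟩
  have hg : Function.Injective g := by
    intro a b hab
    by_contra hne
    have hclose : ∀ σ, K a σ ≤ K b σ + 1 / N := by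
      intro σ
      have h1 : ⌊N * K a σ⌋₊ = ⌊N * K b σ⌋₊ := congrArg Fin.val (congrFun hab σ)
      have h2 := Nat.lt_floor_add_one (N * K a σ)
      have h3 := Nat.floor_le (mul_nonneg hNR.le (hK0 b σ))
      rw [h1] at h2
      have h4 : N * K a σ ≤ N * (K b σ + 1 / N) := by
        rw [mul_add, mul_one_div_cancel hNR.ne']
        linarith
      exact le_of_mul_le_mul_left h4 hNR
    have h1 : ∑ σ, μ a σ * K a σ ≤ ∑ σ, μ a σ * (K b σ + 1 / N) :=
      Finset.sum_le_sum fun σ _ => mul_le_mul_of_nonneg_left (hclose σ) (hμ a σ)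
    simp only [mul_add, Finset.sum_add_distrib, ← Finset.sum_mul, hsum, one_mul] at h1
    linarith [hacc a, hrej a b hne]
  simpa using Fintype.card_le_of_injective g hg

theorem sub_two_mul_sq_le_log {x : ℝ} (hx : -(1 / 2) ≤ x) :
    x - 2 * x ^ 2 ≤ Real.log (1 + x) := by
  have h0 : 0 < 1 + x := by linarith
  refine le_trans ?_ (Real.one_sub_inv_le_log_of_pos h0)
  have h1 : 1 - (1 + x)⁻¹ = x - x ^ 2 / (1 + x) := by field_simp; ring
  have h2 : x ^ 2 / (1 + x) ≤ 2 * x ^ 2 := by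
    rw [div_le_iff₀ h0]
    nlinarith [sq_nonneg x]
  linarith

/-- Random access codes: if every bit of the codeword `b π` can be read from a random `σ` with
success probability `p`, then the number of states is almost the number of codewords. -/
theorem card_mul_pow_le_card_of_readable {S Q D : Type*} [Fintype S] [Fintype Q] [Fintype D]
    (b : Q → D → Bool) (hb : Function.Injective b) (μ : Q → S → ℝ) (q : D → S → Bool → ℝ)
    (p : ℝ) (hp : 1 / 2 < p) (hp1 : p ≤ 1)
    (hμ : ∀ π σ, 0 ≤ μ π σ) (hsum : ∀ π, ∑ σ, μ π σ = 1)
    (hq0 : ∀ d σ β, 0 ≤ q d σ β) (hq1 : ∀ d σ, q d σ true + q d σ false ≤ 1)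
    (hread : ∀ π d, p ≤ ∑ σ, μ π σ * q d σ (b π d)) :
    (Fintype.card Q : ℝ) * (Real.exp ((2 * p - 1) ^ 2 / 8) / 2) ^ Fintype.card D
      ≤ Fintype.card S := by
  classical
  -- This maximises δ(2p-1) - 2δ², with value (2p-1)²/8.
  set δ : ℝ := (2 * p - 1) / 4 with hδ
  have hδ0 : 0 < δ := by rw [hδ]; linarith
  have hδ1 : δ ≤ 1 / 4 := by rw [hδ]; linarith
  have hqle : ∀ d σ β, q d σ β ≤ 1 := by
    intro d σ β
    cases β <;> linarith [hq1 d σ, hq0 d σ true, hq0 d σ false]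
  -- A guess for bit `d` given `σ`, damped towards 1/2 so that its logarithm stays bounded. The
  -- products over `d` give a subprobability on codewords for each `σ`.
  let w : D → S → Bool → ℝ := fun d σ β => (1 + δ * (2 * q d σ β - 1)) / 2
  have hxlow : ∀ d σ β, -(1 / 2) ≤ δ * (2 * q d σ β - 1) := by
    intro d σ β
    nlinarith [hq0 d σ β, mul_nonneg hδ0.le (hq0 d σ β)]
  have hxsq : ∀ d σ β, (δ * (2 * q d σ β - 1)) ^ 2 ≤ δ ^ 2 := by
    intro d σ β
    rw [mul_pow]
    have : (2 * q d σ β - 1) ^ 2 ≤ 1 := by nlinarith [hq0 d σ β, hqle d σ β]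
    nlinarith [sq_nonneg δ]
  have hw0 : ∀ d σ β, 0 < w d σ β := by
    intro d σ β
    have := hxlow d σ β
    simp only [w]
    linarith
  have hwsum : ∀ d σ, ∑ β, w d σ β ≤ 1 := by
    intro d σ
    rw [Fintype.sum_bool]
    simp only [w]
    nlinarith [hq1 d σ]
  have htotal : ∀ σ, ∑ π, ∏ d, w d σ (b π d) ≤ 1 := by
    intro σ
    calc ∑ π, ∏ d, w d σ (b π d)
        = ∑ x ∈ univ.image b, ∏ d, w d σ (x d) := by
          rw [Finset.sum_image fun _ _ _ _ h => hb h]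
      _ ≤ ∑ x : D → Bool, ∏ d, w d σ (x d) :=
          Finset.sum_le_sum_of_subset_of_nonneg (Finset.subset_univ _)
            fun x _ _ => Finset.prod_nonneg fun d _ => (hw0 d σ _).le
      _ = ∏ d, ∑ β, w d σ β := by
          rw [Finset.prod_univ_sum, Fintype.piFinset_univ]
      _ ≤ 1 := Finset.prod_le_one
          (fun d _ => Finset.sum_nonneg fun β _ => (hw0 d σ β).le) fun d _ => hwsum d σ
  have hlarge : ∀ π, (Real.exp ((2 * p - 1) ^ 2 / 8) / 2) ^ Fintype.card D
      ≤ ∑ σ, ∏ d, w d σ (b π d) := by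
    intro π
    have havg : (Fintype.card D : ℝ) * ((2 * p - 1) ^ 2 / 8) ≤
        ∑ σ, μ π σ * ∑ d, Real.log (1 + δ * (2 * q d σ (b π d) - 1)) := by
      simp_rw [Finset.mul_sum]
      rw [Finset.sum_comm]
      rw [← nsmul_eq_mul, ← Finset.card_univ]
      refine Finset.card_nsmul_le_sum _ _ _ fun d _ => ?_
      have h1 : ∑ σ, μ π σ * (2 * δ * q d σ (b π d) + (-δ - 2 * δ ^ 2)) ≤
          ∑ σ, μ π σ * Real.log (1 + δ * (2 * q d σ (b π d) - 1)) := by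
        refine Finset.sum_le_sum fun σ _ => mul_le_mul_of_nonneg_left ?_ (hμ π σ)
        have := sub_two_mul_sq_le_log (hxlow d σ (b π d))
        linarith [hxsq d σ (b π d)]
      refine le_trans ?_ h1
      simp only [mul_add, Finset.sum_add_distrib, ← Finset.sum_mul, hsum, one_mul]
      have h2 : ∑ σ, μ π σ * (2 * δ * q d σ (b π d))
          = 2 * δ * ∑ σ, μ π σ * q d σ (b π d) := by
        rw [Finset.mul_sum]
        exact Finset.sum_congr rfl fun σ _ => by ring
      rw [h2]
      have h3 := mul_le_mul_of_nonneg_left (hread π d) (by positivity : 0 ≤ 2 * δ)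
      have h4 : (2 * p - 1) ^ 2 / 8 = 2 * δ * p + (-δ - 2 * δ ^ 2) := by
        rw [hδ]; ring
      linarith
    obtain ⟨σ, hσ⟩ := exists_le_of_le_weighted_sum _ _ _ (hμ π) (hsum π) havg
    refine le_trans ?_ (Finset.single_le_sum (f := fun σ => ∏ d, w d σ (b π d))
      (fun σ _ => Finset.prod_nonneg fun d _ => (hw0 d σ _).le) (Finset.mem_univ σ))
    have hpos : ∀ d, 0 < 1 + δ * (2 * q d σ (b π d) - 1) := by
      intro d
      linarith [hxlow d σ (b π d)]
    simp only [w, Finset.prod_div_distrib, Finset.prod_const, Finset.card_univ]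
    rw [div_pow, ← Real.exp_nat_mul]
    gcongr
    rw [← Real.le_log_iff_exp_le (Finset.prod_pos fun d _ => hpos d),
      Real.log_prod fun d _ => (hpos d).ne']
    exact hσ
  calc (Fintype.card Q : ℝ) * (Real.exp ((2 * p - 1) ^ 2 / 8) / 2) ^ Fintype.card D
      = ∑ _π : Q, (Real.exp ((2 * p - 1) ^ 2 / 8) / 2) ^ Fintype.card D := by simp
    _ ≤ ∑ π, ∑ σ, ∏ d, w d σ (b π d) := Finset.sum_le_sum fun π _ => hlarge π
    _ = ∑ σ, ∑ π, ∏ d, w d σ (b π d) := Finset.sum_comm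
    _ ≤ ∑ _σ : S, (1 : ℝ) := Finset.sum_le_sum fun σ _ => htotal σ
    _ = Fintype.card S := by simp

/-! ### Real-valued probabilities and the first window -/

theorem PMF.sum_toReal {S : Type*} [Fintype S] (μ : PMF S) : ∑ σ, (μ σ).toReal = 1 := by
  rw [← ENNReal.toReal_sum fun σ _ => μ.apply_ne_top σ, ← tsum_fintype (L := .unconditional S),
    μ.tsum_coe, ENNReal.toReal_one]

theorem PMF.toReal_bind_apply {S β : Type*} [Fintype S] (μ : PMF S) (K : S → PMF β) (v : β) :
    (μ.bind K v).toReal = ∑ σ, (μ σ).toReal * (K σ v).toReal := by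
  rw [PMF.bind_apply, tsum_fintype, ENNReal.toReal_sum]
  · simp only [ENNReal.toReal_mul]
  · exact fun σ _ => ENNReal.mul_ne_top (μ.apply_ne_top σ) ((K σ).apply_ne_top v)

theorem PMF.toReal_apply_add_le_one {β : Type*} (μ : PMF β) {u v : β} (h : u ≠ v) :
    (μ u).toReal + (μ v).toReal ≤ 1 := by
  classical
  rw [← ENNReal.toReal_add (μ.apply_ne_top u) (μ.apply_ne_top v)]
  refine ENNReal.toReal_le_of_le_ofReal zero_le_one ?_
  rw [ENNReal.ofReal_one, ← μ.tsum_coe, ← Finset.sum_pair h]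
  exact ENNReal.sum_le_tsum (f := μ) _

theorem PMF.toReal_apply_le_one {β : Type*} (μ : PMF β) (v : β) : (μ v).toReal ≤ 1 :=
  ENNReal.toReal_le_of_le_ofReal zero_le_one (by simpa using μ.coe_le_one v)

namespace OnlineAlgorithm

/-- The law of the memory content after `n` symbols of `T`, started from the content `σ`. -/
noncomputable def runLaw {α : Type*} {m s : ℕ} (A : OnlineAlgorithm α m s) (T : ℕ → α)
    (σ : Fin s → Bool) : ℕ → PMF (Fin s → Bool)
  | 0 => PMF.pure σ
  | n + 1 => (A.runLaw T σ n).bind fun τ => (A.step τ (T n)).map Prod.fst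

/-- The law of the number reported on the arrival of `T n`, started from the content `σ`. -/
noncomputable def reportLaw {α : Type*} {m s : ℕ} (A : OnlineAlgorithm α m s) (T : ℕ → α) (n : ℕ)
    (σ : Fin s → Bool) : PMF ℕ :=
  (A.runLaw T σ n).bind fun τ => (A.step τ (T n)).map Prod.snd

theorem stateLaw_eq_bind {α : Type*} {m s : ℕ} (A : OnlineAlgorithm α m s) (P : Fin m → α)
    (T : ℕ → α) (n : ℕ) : A.stateLaw P T n = (A.init P).bind fun σ => A.runLaw T σ n := by
  induction n with
  | zero => simp [stateLaw, runLaw]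
  | succ n ih => simp only [stateLaw, runLaw, ih, PMF.bind_bind]

theorem outputLaw_eq_bind {α : Type*} {m s : ℕ} (A : OnlineAlgorithm α m s) (P : Fin m → α)
    (T : ℕ → α) (n : ℕ) : A.outputLaw P T n = (A.init P).bind (A.reportLaw T n) := by
  simp only [outputLaw, stateLaw_eq_bind, PMF.bind_bind]
  rfl

/-- The success guarantee for the first full window, as an average over the initial memory. -/
theorem SolvesHamming.le_sum {α : Type*} [DecidableEq α] {m s : ℕ} {A : OnlineAlgorithm α m s}
    {p : ℝ} (h : A.SolvesHamming p) (hm : 1 ≤ m) (P : Fin m → α) (T : ℕ → α) :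
    p ≤ ∑ σ, (A.init P σ).toReal *
      (A.reportLaw T (m - 1) σ (hammingDist P fun j : Fin m => T j)).toReal := by
  have h1 := h P T 0 (m - 1) (by omega)
  simp only [Nat.zero_add] at h1
  rw [outputLaw_eq_bind] at h1
  rw [← PMF.toReal_bind_apply]
  exact (ENNReal.ofReal_le_iff_le_toReal (PMF.apply_ne_top _ _)).1 h1

theorem SolvesHamming.le_one {α : Type*} [DecidableEq α] [Nonempty α] {m s : ℕ}
    {A : OnlineAlgorithm α m s} {p : ℝ} (h : A.SolvesHamming p) (hm : 1 ≤ m) : p ≤ 1 := by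
  obtain ⟨a⟩ := ‹Nonempty α›
  refine (h.le_sum hm (fun _ => a) fun _ => a).trans ?_
  rw [← PMF.toReal_bind_apply]
  exact PMF.toReal_apply_le_one _ _

theorem SolvesHamming.le_sum_const {α : Type*} [DecidableEq α] {m s : ℕ}
    {A : OnlineAlgorithm α m s} {p : ℝ} (h : A.SolvesHamming p) (hm : 1 ≤ m) (a : α) :
    p ≤ ∑ σ, (A.init (fun _ => a) σ).toReal *
      (A.reportLaw (fun _ => a) (m - 1) σ 0).toReal := by
  simpa using h.le_sum hm (fun _ => a) fun _ => a

theorem SolvesHamming.sum_const_le {α : Type*} [DecidableEq α] {m s : ℕ}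
    {A : OnlineAlgorithm α m s} {p : ℝ} (h : A.SolvesHamming p) (hm : 1 ≤ m) {a b : α}
    (hab : a ≠ b) : ∑ σ, (A.init (fun _ => a) σ).toReal *
      (A.reportLaw (fun _ => b) (m - 1) σ 0).toReal ≤ 1 - p := by
  have h1 := h.le_sum hm (fun _ => a) fun _ => b
  rw [← PMF.toReal_bind_apply] at h1 ⊢
  have hd : hammingDist (fun _ : Fin m => a) (fun _ => b) ≠ 0 := by
    rw [hammingDist_ne_zero]
    exact fun he => hab (congrFun he ⟨0, hm⟩)
  linarith [PMF.toReal_apply_add_le_one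
    ((A.init fun _ => a).bind (A.reportLaw (fun _ => b) (m - 1))) hd]

/-- Without memory the reports cannot depend on the pattern. The bound later absorbs additive
constants and small `m`. -/
theorem SolvesHamming.one_le_space {α : Type*} [DecidableEq α] [Nontrivial α] {m s : ℕ}
    {A : OnlineAlgorithm α m s} {p : ℝ} (h : A.SolvesHamming p) (hm : 1 ≤ m) (hp : 1 / 2 < p) :
    1 ≤ s := by
  by_contra! hs
  obtain rfl : s = 0 := by omega
  obtain ⟨a, b, hab⟩ := exists_pair_ne α
  have hinit : ∀ P σ, (A.init P σ).toReal = 1 := by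
    intro P σ
    rw [← (A.init P).sum_toReal, Fintype.sum_subsingleton _ σ]
  have h1 := h.le_sum_const hm b
  have h2 := h.sum_const_le hm hab
  simp only [hinit] at h1 h2
  linarith

theorem SolvesHamming.card_le {α : Type*} [DecidableEq α] [Fintype α] {m s : ℕ}
    {A : OnlineAlgorithm α m s} {p : ℝ} (h : A.SolvesHamming p) (hm : 1 ≤ m) {N : ℕ} (hN : 0 < N)
    (hNp : 1 / (N : ℝ) < 2 * p - 1) : Fintype.card α ≤ (N + 1) ^ 2 ^ s := by
  have := card_le_pow_of_distinguish (fun (a : α) σ => (A.init (fun _ => a) σ).toReal)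
    (fun a σ => (A.reportLaw (fun _ => a) (m - 1) σ 0).toReal) p N hN hNp
    (fun _ _ => ENNReal.toReal_nonneg) (fun _ => PMF.sum_toReal _)
    (fun _ _ => ENNReal.toReal_nonneg) (fun _ _ => PMF.toReal_apply_le_one _ _)
    (fun a => h.le_sum_const hm a) (fun _ _ hab => h.sum_const_le hm hab)
  simpa using this

end OnlineAlgorithm

/-! ### Reading the digits of a permutation -/

/-- The distance between a permutation and a window that shows the symbol `e j` at the positions
`x` in a set and a foreign symbol elsewhere reveals whether the position of `e j` is in the set. -/
theorem hammingDist_perm_indicator {α : Type*} [DecidableEq α] {m : ℕ} (e : Fin m ↪ α) (z : α)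
    (hz : ∀ j, e j ≠ z) (π : Equiv.Perm (Fin m)) (j : Fin m) (f : Fin m → Bool) :
    hammingDist (fun x => e (π.symm x)) (fun x => if f x then e j else z)
      = m - (f (π j)).toNat := by
  have hfilter : (univ.filter fun x => e (π.symm x) ≠ if f x then e j else z)
      = univ \ (if f (π j) then {π j} else ∅) := by
    ext x
    by_cases hx : x = π j
    · subst hx
      by_cases hf : f (π j) <;> simp [hf, hz]
    · have hx' : π.symm x ≠ j := fun h => hx (by rw [← h, Equiv.apply_symm_apply])
      by_cases hf : f x <;> by_cases hf' : f (π j) <;> simp [hf, hf', hz, hx, hx']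
  unfold hammingDist
  rw [hfilter, Finset.card_sdiff_of_subset (Finset.subset_univ _), Finset.card_univ,
    Fintype.card_fin]
  by_cases hf : f (π j) <;> simp [hf]

theorem perm_testBit_injective (m : ℕ) : Function.Injective
    fun (π : Equiv.Perm (Fin m)) (d : Fin m × Fin (Nat.clog 2 m)) =>
      (π d.1 : ℕ).testBit d.2 := by
  intro π ρ h
  ext j
  refine Nat.eq_of_testBit_eq fun l => ?_
  by_cases hl : l < Nat.clog 2 m
  · exact congrFun h (j, ⟨l, hl⟩)
  · have hbig : m ≤ 2 ^ l :=
      (Nat.le_pow_clog one_lt_two m).trans (Nat.pow_le_pow_right two_pos (not_lt.1 hl))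
    rw [Nat.testBit_lt_two_pow ((π j).2.trans_le hbig),
      Nat.testBit_lt_two_pow ((ρ j).2.trans_le hbig)]

namespace OnlineAlgorithm

theorem SolvesHamming.factorial_mul_pow_le {α : Type*} [DecidableEq α] {m s : ℕ}
    {A : OnlineAlgorithm α m s} {p : ℝ} (h : A.SolvesHamming p) (hm : 1 ≤ m) (hp : 1 / 2 < p)
    (e : Fin m ↪ α) (z : α) (hz : ∀ j, e j ≠ z) :
    (m.factorial : ℝ) * (Real.exp ((2 * p - 1) ^ 2 / 8) / 2) ^ (m * Nat.clog 2 m) ≤ 2 ^ s := by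
  have : Nonempty α := ⟨z⟩
  let T : Fin m × Fin (Nat.clog 2 m) → ℕ → α := fun d x => if x.testBit d.2 then e d.1 else z
  have key := card_mul_pow_le_card_of_readable _ (perm_testBit_injective m)
    (fun π σ => (A.init (fun x => e (π.symm x)) σ).toReal)
    (fun d σ β => (A.reportLaw (T d) (m - 1) σ (m - β.toNat)).toReal) p hp (h.le_one hm)
    (fun _ _ => ENNReal.toReal_nonneg) (fun _ => PMF.sum_toReal _)
    (fun _ _ _ => ENNReal.toReal_nonneg)
    -- The answers m - 1 and m differ despite truncated subtraction, because m ≥ 1.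
    (fun _ _ => PMF.toReal_apply_add_le_one _ (by simp; omega))
    (fun π d => by
      have h1 := h.le_sum hm (fun x => e (π.symm x)) (T d)
      have h2 := hammingDist_perm_indicator e z hz π d.1 fun x => (x : ℕ).testBit d.2
      simp only [T] at h1
      rw [h2] at h1
      exact h1)
  simpa [Fintype.card_perm] using key

end OnlineAlgorithm

/-! ### Asymptotics and choice of constants -/

theorem pow_div_exp_le_factorial (m : ℕ) : (m : ℝ) ^ m / Real.exp m ≤ m.factorial := by
  have h := Real.pow_div_factorial_le_exp (m : ℝ) (Nat.cast_nonneg m) m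
  rw [div_le_iff₀ (by positivity)] at h ⊢
  linarith

theorem le_of_factorial_mul_pow_le {m s : ℕ} (hm : 2 ≤ m) {η : ℝ} (hη : 0 ≤ η)
    (h : (m.factorial : ℝ) * (Real.exp η / 2) ^ (m * Nat.clog 2 m) ≤ 2 ^ s) :
    m * (η * Real.logb 2 m - 2) ≤ s := by
  have hm0 : (0 : ℝ) < m := by exact_mod_cast (by omega : 0 < m)
  set L := Nat.clog 2 m with hL
  have hlow : Real.logb 2 m ≤ L := by
    rw [Real.logb_le_iff_le_rpow one_lt_two hm0, Real.rpow_natCast]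
    exact_mod_cast Nat.le_pow_clog one_lt_two m
  -- Rounding up to `L` digits costs at most a factor 2 per symbol, hence only O(m) bits.
  have hup : (2 : ℝ) ^ L ≤ 2 * m := by
    have h1 : 2 ^ (L - 1) < m := Nat.pow_pred_clog_lt_self one_lt_two (by omega)
    have h2 : 0 < L := Nat.clog_pos one_lt_two hm
    obtain ⟨k, hk⟩ : ∃ k, L = k + 1 := ⟨L - 1, by omega⟩
    rw [hk] at h1 ⊢
    have h3 : (2 : ℝ) ^ k < m := by exact_mod_cast h1
    rw [pow_succ]
    linarith
  have h1 : Real.log ((m : ℝ) ^ m / Real.exp m * (Real.exp η / 2) ^ (m * L))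
      ≤ Real.log ((2 : ℝ) ^ s) := by
    refine Real.log_le_log (by positivity) (le_trans ?_ h)
    exact mul_le_mul_of_nonneg_right (pow_div_exp_le_factorial m) (by positivity)
  rw [Real.log_mul (by positivity) (by positivity), Real.log_div (by positivity) (by positivity),
    Real.log_pow, Real.log_pow, Real.log_pow, Real.log_exp,
    Real.log_div (by positivity) (by positivity), Real.log_exp] at h1
  have h2 := Real.log_le_log (by positivity) hup
  rw [Real.log_pow, Real.log_mul (by positivity) hm0.ne'] at h2
  push_cast at h1
  have hlog2 : Real.log 2 ≤ 1 := by linarith [Real.log_two_lt_d9]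
  have h3 : (s : ℝ) * Real.log 2 ≤ s := mul_le_of_le_one_right (Nat.cast_nonneg s) hlog2
  have h4 : η * Real.logb 2 m ≤ η * L := mul_le_mul_of_nonneg_left hlow hη
  have h5 : (m : ℝ) * (η * Real.logb 2 m - 2)
      ≤ m * (Real.log m - 1 + (η * L - L * Real.log 2)) :=
    mul_le_mul_of_nonneg_left (by linarith) hm0.le
  nlinarith

theorem eventually_alphabet_large (ε : ℝ) (hε : 0 < ε) (c : ℝ) (hc : 0 < c) (η : ℝ) (hη : 0 < η) :
    ∃ M : ℕ, 2 ≤ M ∧ ∀ m : ℕ, M ≤ m →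
      (m : ℝ) + 1 ≤ c * (m : ℝ) ^ (1 + ε) ∧ 4 ≤ η * Real.logb 2 m := by
  have h1 : ∀ᶠ m : ℕ in Filter.atTop, 2 / c ≤ (m : ℝ) ^ ε :=
    ((tendsto_rpow_atTop hε).comp tendsto_natCast_atTop_atTop).eventually_ge_atTop _
  have h2 : ∀ᶠ m : ℕ in Filter.atTop, 4 / η ≤ Real.logb 2 m :=
    ((Real.tendsto_logb_atTop one_lt_two).comp tendsto_natCast_atTop_atTop).eventually_ge_atTop _
  obtain ⟨M, hM⟩ := Filter.eventually_atTop.1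
    ((h1.and h2).and (Filter.eventually_ge_atTop 2))
  refine ⟨M, (hM M le_rfl).2, fun m hm => ?_⟩
  obtain ⟨⟨ha, hb⟩, hm2⟩ := hM m hm
  have hmR : (2 : ℝ) ≤ m := by exact_mod_cast hm2
  rw [div_le_iff₀' hc] at ha
  rw [div_le_iff₀' hη] at hb
  refine ⟨?_, hb⟩
  rw [Real.rpow_add (by linarith), Real.rpow_one]
  nlinarith

theorem logb_logb_le_of_le_pow {U N s : ℕ} (hU : 2 ≤ U) (hN : 0 < N) (h : U ≤ (N + 1) ^ 2 ^ s) :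
    Real.logb 2 (Real.logb 2 U) ≤ s + Real.logb 2 (Real.logb 2 ((N : ℝ) + 1)) := by
  have hUR : (2 : ℝ) ≤ U := by exact_mod_cast hU
  have hNR : (1 : ℝ) ≤ N := by exact_mod_cast hN
  have h1 : Real.logb 2 U ≤ 2 ^ s * Real.logb 2 ((N : ℝ) + 1) := by
    have h2 : (U : ℝ) ≤ ((N : ℝ) + 1) ^ 2 ^ s := by exact_mod_cast h
    have h3 := Real.logb_le_logb_of_le one_lt_two (by linarith) h2
    rw [Real.logb_pow] at h3
    exact_mod_cast h3
  have hU0 : 0 < Real.logb 2 U := Real.logb_pos one_lt_two (by linarith)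
  have hN0 : 0 < Real.logb 2 ((N : ℝ) + 1) := Real.logb_pos one_lt_two (by linarith)
  have h4 := Real.logb_le_logb_of_le one_lt_two hU0 h1
  rwa [Real.logb_mul (by positivity) hN0.ne', Real.logb_pow, Real.logb_self_eq_one one_lt_two,
    mul_one] at h4

theorem mainTheorem5 (ε : ℝ) (hε : 0 < ε) (c : ℝ) (hc : 0 < c) (p : ℝ) (hp : 1 / 2 < p) :
    ∃ C : ℝ, 0 < C ∧
      ∀ m U : ℕ, 1 ≤ m → 2 ≤ U → c * (m : ℝ) ^ (1 + ε) ≤ (U : ℝ) →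
        ∀ (s : ℕ) (A : OnlineAlgorithm (Fin U) m s), A.SolvesHamming p →
          C * ((m : ℝ) * Real.logb 2 m + Real.logb 2 (Real.logb 2 U)) ≤ (s : ℝ) := by
  set η : ℝ := (2 * p - 1) ^ 2 / 8 with hηdef
  have hη : 0 < η := by
    have : 0 < 2 * p - 1 := by linarith
    positivity
  obtain ⟨M, hM2, hM⟩ := eventually_alphabet_large ε hε c hc η hη
  obtain ⟨k, hk⟩ := exists_nat_one_div_lt (show 0 < 2 * p - 1 by linarith)
  set κ : ℝ := |Real.logb 2 (Real.logb 2 (((k + 1 : ℕ) : ℝ) + 1))| with hκ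
  have hκ0 : 0 ≤ κ := abs_nonneg _
  set B : ℝ := M * Real.logb 2 M + 2 / η with hB
  have hMR : (2 : ℝ) ≤ M := by exact_mod_cast hM2
  have hlogM : 0 ≤ Real.logb 2 M := Real.logb_nonneg one_lt_two (by linarith)
  have hB0 : 0 < B := by positivity
  -- `B` pays for m log m, its first summand covering m < M, and 1 + κ pays for log log U.
  refine ⟨1 / (B + (1 + κ)), by positivity, fun m U hm hU hUm s A hA => ?_⟩
  have : Nontrivial (Fin U) := Fin.nontrivial_iff_two_le.2 hU
  have hs : (1 : ℝ) ≤ s := by exact_mod_cast hA.one_le_space hm hp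
  have hmR : (1 : ℝ) ≤ m := by exact_mod_cast hm
  have hloglog : Real.logb 2 (Real.logb 2 U) ≤ (1 + κ) * s := by
    have hcard := hA.card_le hm (N := k + 1) (Nat.succ_pos k) (by exact_mod_cast hk)
    rw [Fintype.card_fin] at hcard
    have h1 := logb_logb_le_of_le_pow hU (Nat.succ_pos k) hcard
    have h2 := le_abs_self (Real.logb 2 (Real.logb 2 (((k + 1 : ℕ) : ℝ) + 1)))
    nlinarith
  have hmlog : (m : ℝ) * Real.logb 2 m ≤ B * s := by
    rcases lt_or_ge m M with hlt | hge
    · have hle : (m : ℝ) ≤ M := by exact_mod_cast hlt.le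
      have h1 : (m : ℝ) * Real.logb 2 m ≤ M * Real.logb 2 M :=
        mul_le_mul hle (Real.logb_le_logb_of_le one_lt_two (by linarith) hle)
          (Real.logb_nonneg one_lt_two hmR) (by linarith)
      have h2 : 0 < 2 / η := by positivity
      nlinarith
    · obtain ⟨h1, h2⟩ := hM m hge
      have hmU : m + 1 ≤ U := by exact_mod_cast h1.trans hUm
      have h3 := hA.factorial_mul_pow_le hm hp (Fin.castLEEmb (by omega : m ≤ U))
        ⟨m, hmU⟩ fun j hj => j.2.ne (congrArg Fin.val hj)
      have h4 := le_of_factorial_mul_pow_le (hM2.trans hge) hη.le h3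
      -- As η log₂ m ≥ 4, subtracting 2 loses at most half.
      have h5 : (m : ℝ) * (η * Real.logb 2 m) ≤ 2 * s := by nlinarith
      have h6 : (m : ℝ) * Real.logb 2 m ≤ 2 / η * s := by
        rw [div_mul_eq_mul_div, le_div_iff₀ hη]
        linarith
      have h7 : 0 ≤ (M : ℝ) * Real.logb 2 M := by positivity
      nlinarith
  rw [div_mul_eq_mul_div, one_mul, div_le_iff₀ (by positivity)]
  linarith
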